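/- An ideal $\mathcal I$ over a set $X$ (a family of subsets of $X$ closed under subsets and finite unions, with $X\notin\mathcal I$) is *uniform* if it contains every subset of $X$ of cardinality less than $|X|$; a set is *$\mathcal I$-positive* if it is not in $\mathcal I$. The ideal $\mathcal I$ is *$(\mu,\lambda,\theta)$-saturated* if for every family $\{A_\alpha:\alpha<\mu\}$ of $\mathcal I$-positive sets there is a set of indices $J\subseteq\mu$ with $|J|=\lambda$ such that $\bigcap_{\alpha\in C}A_\alpha$ is $\mathcal I$-positive for every $C\subseteq J$ with $|C|=\theta$. An ideal over $\kappa^+$ is *weakly Laver* if it is uniform, $\kappa^+$-complete (closed under unions of at most $\kappa$ of its members) and $(\kappa^{++},\kappa^+,\kappa)$-saturated; thus for $\kappa=\aleph_0$ this means uniform, $\sigma$-complete and $(\aleph_2,\aleph_1,\aleph_0)$-saturated. *Chang's conjecture* is the statement that every structure $\mathfrak A=(A,R,\dots)$ in a countable first-order language, with a distinguished unary predicate $R$, $|A|=\aleph_2$ and $|R|=\aleph_1$, has an elementary substructure $\mathfrak B\prec\mathfrak A$ with $|B|=\aleph_1$ and $|R^{\mathfrak B}|=\aleph_0$. **Theorem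 1.2.** Assume Martin's axiom, $2^{\aleph_0}>\aleph_2$, and the failure of Chang's conjecture. Then there is no weakly Laver ideal over $\aleph_1$. In particular, the ideal $\mathrm{NS}_{\omega_1}$ of nonstationary subsets of $\omega_1$ is not weakly Laver; since it is uniform and $\sigma$-complete, this says that it is not $(\aleph_2,\aleph_1,\aleph_0)$-saturated. -/

import Mathlib

open Cardinal Ordinal

/-! ### Martin's axiom

Forcing conditions are ordered so that `p ≤ q` means that `q` is stronger than `p`. With this
convention compatibility is the existence of a common upper bound, dense sets are the cofinal sets,
and generic objects are downward closed and upward directed, that is, `Order.Ideal`s. -/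

/-- Two conditions are compatible when they have a common extension. -/
def ForcingCompatible {P : Type} [Preorder P] (p q : P) : Prop :=
  ∃ r, p ≤ r ∧ q ≤ r

/-- The countable chain condition: every set of pairwise incompatible conditions is countable. -/
def CountableChainCondition (P : Type) [Preorder P] : Prop :=
  ∀ A : Set P, A.Pairwise (fun p q => ¬ ForcingCompatible p q) → A.Countable

/-- Martin's axiom: for every nonempty ccc forcing notion and every family of fewer than `2 ^ ℵ₀`
dense sets there is a generic set meeting all members of the family. -/
def MartinsAxiom : Prop :=
  ∀ (P : Type) [Preorder P] [Nonempty P], CountableChainCondition P →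
    ∀ (ι : Type) (D : ι → Set P), #ι < 2 ^ ℵ₀ → (∀ i, IsCofinal (D i)) →
      ∃ G : Order.Ideal P, ∀ i, ((G : Set P) ∩ D i).Nonempty

/-! ### Chang's conjecture -/

/-- Chang's conjecture `(ℵ₂, ℵ₁) ↠ (ℵ₁, ℵ₀)`: every structure `A` in a countable first order
language with a distinguished unary predicate `R`, such that `|A| = ℵ₂` and `|R| = ℵ₁`, has an
elementary substructure `B` with `|B| = ℵ₁` and `|R ∩ B| = ℵ₀`. -/
def ChangsConjecture : Prop :=
  ∀ (L : FirstOrder.Language.{0, 0}) (R : L.Relations 1) (A : Type) [L.Structure A],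
    L.card ≤ ℵ₀ → #A = ℵ_ 2 →
    #{a : A | FirstOrder.Language.Structure.RelMap R ![a]} = ℵ_ 1 →
    ∃ B : L.ElementarySubstructure A,
      #B = ℵ_ 1 ∧ #{b : B | FirstOrder.Language.Structure.RelMap R ![b]} = ℵ₀

/-! ### Ideals

An ideal over `X` is an `Order.Ideal (Set X)`: a nonempty family of subsets of `X` that is closed
under subsets and finite unions. The positive sets are those that are not in the ideal. -/

/-- An ideal over `X` is uniform when it contains all sets of cardinality smaller than `|X|`. -/
def IsUniformIdeal {X : Type} (I : Order.Ideal (Set X)) : Prop :=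
  ∀ A : Set X, #A < #X → A ∈ I

/-- An ideal is `κ`-complete when it is closed under unions of fewer than `κ` of its members. -/
def IsCompleteIdeal {X : Type} (κ : Cardinal.{0}) (I : Order.Ideal (Set X)) : Prop :=
  ∀ S : Set (Set X), #S < κ → (∀ A ∈ S, A ∈ I) → ⋃₀ S ∈ I

/-- `(μ, ν, θ)`-saturation: every family of `μ` positive sets has a subfamily of size `ν` such that
the intersection of any `θ` of its members is positive. -/
def IsSaturatedIdeal {X : Type} (μ ν θ : Cardinal.{0}) (I : Order.Ideal (Set X)) : Prop :=
  ∀ (ι : Type) (A : ι → Set X), #ι = μ → (∀ i, A i ∉ I) →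
    ∃ J : Set ι, #J = ν ∧ ∀ C ⊆ J, #C = θ → (⋂ i ∈ C, A i) ∉ I

/-- A weakly Laver ideal over a set `X` of size `κ⁺`: a proper, uniform, `κ⁺`-complete and
`(κ⁺⁺, κ⁺, κ)`-saturated ideal. -/
structure IsWeaklyLaver {X : Type} (κ : Cardinal.{0}) (I : Order.Ideal (Set X)) : Prop where
  card_eq : #X = Order.succ κ
  proper : I.IsProper
  uniform : IsUniformIdeal I
  complete : IsCompleteIdeal (Order.succ κ) I
  saturated : IsSaturatedIdeal (Order.succ (Order.succ κ)) (Order.succ κ) κ I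

theorem cof_omega1_ne_aleph0 : Order.cof (ω₁ : Ordinal.{0}).ToType ≠ ℵ₀ := by
  have h : Order.cof (ω₁ : Ordinal.{0}).ToType = ℵ₁ := by
    simp
  rw [h]
  exact aleph0_lt_aleph_one.ne'

/-- The ideal `NS` of nonstationary subsets of `ω₁`. -/
def nonstationaryIdeal : Order.Ideal (Set (ω₁ : Ordinal.{0}).ToType) where
  carrier := {A | ¬ IsStationary A}
  lower' := fun _ _ h hA hB => hA (hB.mono h)
  nonempty' := ⟨∅, not_isStationary_empty⟩
  directed' := by
    intro A hA B hB
    obtain ⟨s, hs, hAs⟩ := not_isStationary_iff.1 hA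
    obtain ⟨t, ht, hBt⟩ := not_isStationary_iff.1 hB
    refine ⟨A ∪ B, not_isStationary_iff.2 ⟨s ∩ t, hs.inter cof_omega1_ne_aleph0 ht, ?_⟩,
      Set.subset_union_left, Set.subset_union_right⟩
    exact Set.disjoint_union_left.2
      ⟨hAs.mono_right Set.inter_subset_left, hBt.mono_right Set.inter_subset_right⟩

/-! The failure of Chang's conjecture gives a set `A` of size `ℵ₂` with a coloring `e` of its pairs
by countable ordinals that is subadditive, locally countable and unbounded on every uncountable set
(`exists_isUnboundedColoring`). Unboundedness extends to uncountable families of disjoint finite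
sets (`IsUnboundedColoring.exists_forall_lt`). This makes ccc the finite forcing that adds functions
`F a : ω₁ → ω` for `a` in `A`, where `F a` and `F b` agree only at points up to the color of `{a,
b}`. Only `ℵ₂` dense sets are needed, so Martin's axiom provides `ℵ₂` functions that pairwise agree
on countable sets.

Such functions rule out a weakly Laver ideal: by completeness each has a positive fiber, `ℵ₂` of
these fibers belong to one value, and any two of those meet in a countable set, which uniformity
puts in the ideal. Saturation would demand a positive intersection of infinitely many of them. -/

/-! ### Closure operators from the failure of Chang's conjecture -/

/-- A finitary closure operator that preserves countability, is closed under the operations `f` and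
`g`, and catches uncountably many points of `R` in the closure of any uncountable set. -/
structure IsChangClosure {A : Type} (R : Set A) (f g : A → A → A)
    (c : ClosureOperator (Set A)) : Prop where
  countable : ∀ X : Set A, X.Countable → (c X).Countable
  finitary : ∀ (X : Set A), ∀ x ∈ c X, ∃ F : Set A, F.Finite ∧ F ⊆ X ∧ x ∈ c F
  closed : ∀ (X : Set A), ∀ a ∈ c X, ∀ b ∈ c X, f a b ∈ c X ∧ g a b ∈ c X
  uncountable : ∀ X : Set A, ¬ X.Countable → ¬ (c X ∩ R).Countable

theorem FirstOrder.Language.Substructure.exists_finite_mem_closure {L : FirstOrder.Language}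
    {M : Type*} [L.Structure M] {s : Set M} {x : M} (hx : x ∈ closure L s) :
    ∃ F : Set M, F.Finite ∧ F ⊆ s ∧ x ∈ closure L F := by
  refine closure_induction (p := fun x => ∃ F : Set M, F.Finite ∧ F ⊆ s ∧ x ∈ closure L F) hx
    (fun x hx => ⟨{x}, Set.finite_singleton x, by simpa using hx, subset_closure rfl⟩) ?_
  intro n f y ih
  choose F hF hFs hy using ih
  refine ⟨⋃ i, F i, Set.finite_iUnion hF, Set.iUnion_subset hFs, ?_⟩
  exact Substructure.fun_mem _ f _ fun i => closure_mono (Set.subset_iUnion F i) (hy i)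

/-- The language with countably many constants and two binary operations. -/
def constantsWithTwoOperations : FirstOrder.Language.{0, 0} where
  Functions
    | 0 => ℕ
    | 2 => Bool
    | _ => Empty
  Relations _ := Empty

/-- The structure interpreting the constants by `p` and the operations by `f` and `g`. -/
abbrev constantsWithTwoOperationsStructure {A : Type} (p : ℕ → A) (f g : A → A → A) :
    constantsWithTwoOperations.Structure A where
  funMap {n} := match n with
    | 0 => fun k _ => p k
    | 1 => fun k _ => Empty.elim k
    | 2 => fun (b : Bool) x => bif b then f (x 0) (x 1) else g (x 0) (x 1)
    | _ + 3 => fun k _ => Empty.elim k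
  RelMap r _ := Empty.elim r

theorem countable_constantsWithTwoOperations_functions (n : ℕ) :
    Countable (constantsWithTwoOperations.Functions n) :=
  match n with
  | 0 => inferInstanceAs (Countable ℕ)
  | 1 => inferInstanceAs (Countable Empty)
  | 2 => inferInstanceAs (Countable Bool)
  | _ + 3 => inferInstanceAs (Countable Empty)

theorem FirstOrder.Language.ElementarySubstructure.relMap_singleton_iff
    {L : FirstOrder.Language} {M : Type*} [L.Structure M] {S : L.ElementarySubstructure M}
    (R : L.Relations 1) (b : S) :
    Structure.RelMap R ![b] ↔ Structure.RelMap R ![(b : M)] := by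
  rw [← S.subtype.map_rel R ![b]]
  have : ⇑S.subtype ∘ ![b] = ![(b : M)] := by
    ext i; fin_cases i; rfl
  rw [this]

theorem exists_uncountable_subset_mk_eq_aleph_one {A : Type} {X : Set A} (hX : ¬ X.Countable) :
    ∃ Y ⊆ X, #Y = ℵ_ 1 := by
  have h : ℵ_ 1 ≤ #X := by
    rw [← succ_aleph0, Order.succ_le_iff, ← not_le, le_aleph0_iff_set_countable]
    exact hX
  exact le_mk_iff_exists_subset.1 h

/-- The closure is generated by Skolem functions for a counterexample structure together with `f`
and `g`. The closure of a set of size `ℵ₁` is thus an elementary substructure of size `ℵ₁`, so its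
part in `R` cannot have size `ℵ₀`. -/
theorem exists_isChangClosure_of_not_changsConjecture (hCC : ¬ ChangsConjecture) :
    ∃ (A : Type) (R : Set A), #A = ℵ_ 2 ∧ #R = ℵ_ 1 ∧
      ∀ f g : A → A → A, ∃ c : ClosureOperator (Set A), IsChangClosure R f g c := by
  classical
  unfold ChangsConjecture at hCC
  push Not at hCC
  obtain ⟨L, R, A, _, hL, hA, hR, hB⟩ := hCC
  refine ⟨A, {a | FirstOrder.Language.Structure.RelMap R ![a]}, hA, hR, fun f g => ?_⟩
  have : Infinite {a : A | FirstOrder.Language.Structure.RelMap R ![a]} := by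
    rw [infinite_iff, hR]; exact aleph0_le_aleph 1
  -- Named by constants, these points keep `R` infinite in every closed set, so that a countable
  -- part has size exactly `ℵ₀`.
  let p : ℕ ↪ {a : A | FirstOrder.Language.Structure.RelMap R ![a]} := Infinite.natEmbedding _
  have : Nonempty A := ⟨p 0⟩
  let K := constantsWithTwoOperations
  let : K.Structure A := constantsWithTwoOperationsStructure (fun n => (p n : A)) f g
  let M := (L.sum L.skolem₁).sum K
  have hcountL : Countable (Σ n, (L.sum L.skolem₁).Functions n) := by
    rw [← mk_le_aleph0_iff]
    exact FirstOrder.Language.card_functions_sum_skolem₁_le.trans (max_le le_rfl hL)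
  have hcountM : Countable (Σ n, M.Functions n) := by
    have h : ∀ n, Countable (M.Functions n) := by
      intro n
      have h1 : Countable ((L.sum L.skolem₁).Functions n) :=
        Function.Injective.countable
          (f := fun x => (⟨n, x⟩ : Σ n, (L.sum L.skolem₁).Functions n)) sigma_mk_injective
      have h2 : Countable (K.Functions n) := countable_constantsWithTwoOperations_functions n
      exact inferInstanceAs (Countable ((L.sum L.skolem₁).Functions n ⊕ K.Functions n))
    infer_instance
  let c := (FirstOrder.Language.Substructure.closure M (M := A)).closureOperator
  refine ⟨c, fun X hX => ?_, fun X x hx => ?_, fun X a ha b hb => ?_, fun X hX hc' => ?_⟩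
  · exact (hX.substructure_closure M).to_set
  · exact FirstOrder.Language.Substructure.exists_finite_mem_closure hx
  · have key : ∀ t : Bool, (bif t then f a b else g a b) ∈ c X := by
      intro t
      let F : M.Functions 2 := Sum.inr (show K.Functions 2 from t)
      exact (FirstOrder.Language.Substructure.closure M X).fun_mem F ![a, b] (by
        intro i; fin_cases i <;> assumption)
    exact ⟨by simpa using key true, by simpa using key false⟩
  · obtain ⟨Y, hYX, hY⟩ := exists_uncountable_subset_mk_eq_aleph_one hX
    let T : M.Substructure A := FirstOrder.Language.Substructure.closure M Y
    let S := FirstOrder.Language.LHom.sumInl.substructureReduct (L := L.sum L.skolem₁)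
      (L' := M) T
    have hS : #S = ℵ_ 1 := by
      refine le_antisymm ?_ ?_
      · have := FirstOrder.Language.Substructure.lift_card_closure_le (L := M) (s := Y)
        simp only [Cardinal.lift_id, hY] at this
        refine this.trans (max_le (aleph0_le_aleph 1) ?_)
        exact add_le_of_le (aleph0_le_aleph 1) le_rfl
          ((mk_le_aleph0_iff.2 hcountM).trans (aleph0_le_aleph 1))
      · rw [← hY]
        exact mk_le_mk_of_subset FirstOrder.Language.Substructure.subset_closure
    apply hB S.elementarySkolem₁Reduct hS
    have hsub : (c Y ∩ {a | FirstOrder.Language.Structure.RelMap R ![a]}).Countable :=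
      hc'.mono (Set.inter_subset_inter_left _ (c.monotone hYX))
    refine le_antisymm ?_ ?_
    · rw [mk_le_aleph0_iff]
      have := hsub.to_subtype
      let j : {b : S.elementarySkolem₁Reduct | FirstOrder.Language.Structure.RelMap R ![b]} →
          ↥(c Y ∩ {a | FirstOrder.Language.Structure.RelMap R ![a]}) :=
        fun b => ⟨b.1.1, b.1.2, by
          exact (FirstOrder.Language.ElementarySubstructure.relMap_singleton_iff R b.1).1 b.2⟩
      refine Function.Injective.countable (f := j) fun a b h => ?_
      exact Subtype.ext (Subtype.ext (congrArg (fun x => x.1) h))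
    · rw [aleph0_le_mk_iff]
      let j : ℕ → {b : S.elementarySkolem₁Reduct | FirstOrder.Language.Structure.RelMap R ![b]} :=
        fun n => ⟨⟨p n, by
          let F : M.Functions 0 := Sum.inr (show K.Functions 0 from n)
          exact T.fun_mem F ![] (fun i => i.elim0)⟩, by
          exact (FirstOrder.Language.ElementarySubstructure.relMap_singleton_iff R _).2 (p n).2⟩
      refine Infinite.of_injective j fun a b h => ?_
      exact p.injective (Subtype.ext (congrArg (fun x => x.1.1) h))

/-! ### Countable ordinals -/

/-- The well-ordered type of countable ordinals. -/
abbrev OmegaOne : Type := (ω₁ : Ordinal.{0}).ToType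

namespace OmegaOne

theorem mk_eq : #OmegaOne = ℵ_ 1 := by simp

theorem countable_Iio (w : OmegaOne) : (Set.Iio w).Countable := by
  have h : #(Set.Iio w) < #OmegaOne := mk_Iio_lt w (by simp)
  rw [mk_eq, ← succ_aleph0, Order.lt_succ_iff] at h
  exact (mk_le_aleph0_iff.1 h).to_set

theorem countable_Iic (w : OmegaOne) : (Set.Iic w).Countable := by
  rw [← Set.Iio_union_right]
  exact (countable_Iio w).union (Set.countable_singleton w)

theorem exists_forall_lt {S : Set OmegaOne} (hS : S.Countable) : ∃ b, ∀ s ∈ S, s < b := by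
  by_contra! h
  have hc : (⋃ s ∈ S, Set.Iic s).Countable := hS.biUnion fun s _ => countable_Iic s
  have hu : (⋃ s ∈ S, Set.Iic s) = Set.univ := by
    ext b
    simpa using h b
  rw [hu, Set.countable_univ_iff, ← mk_le_aleph0_iff, mk_eq] at hc
  exact hc.not_gt aleph0_lt_aleph_one

end OmegaOne

/-- Every type of size `ℵ₂` has a linear order all of whose proper initial segments have size at most
`ℵ₁`. -/
theorem exists_linearOrder_mk_Iio_le {A : Type} (hA : #A = ℵ_ 2) :
    ∃ _ : LinearOrder A, ∀ a : A, #(Set.Iio a) ≤ ℵ_ 1 := by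
  obtain ⟨o, ho, h⟩ := exists_ord_eq_type_lt A
  refine ⟨o, fun a => ?_⟩
  have := mk_Iio_lt a h
  rw [hA] at this
  have h2 : ℵ_ 2 = Order.succ (ℵ_ (1 : Ordinal.{0})) := by
    rw [succ_aleph]; norm_num
  rwa [h2, Order.lt_succ_iff] at this

/-! ### The unbounded coloring -/

/-- A coloring of the pairs of a linear order by countable ordinals that is subadditive, locally
countable and unbounded on every uncountable set. -/
structure IsUnboundedColoring {A : Type} [LinearOrder A] (e : A → A → OmegaOne) : Prop where
  le_max : ∀ a b d, a < b → b < d → e a b ≤ max (e a d) (e b d)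
  countable : ∀ b ν, {a | a < b ∧ e a b ≤ ν}.Countable
  unbounded : ∀ Y : Set A, ¬ Y.Countable → ∀ ν, ∃ a ∈ Y, ∃ b ∈ Y, a < b ∧ ν < e a b

section Hull

variable {A : Type} (c : ClosureOperator (Set A)) (ρ : OmegaOne → A)

/-- The closure of `β` together with the first `ν` points of the range of `ρ`. -/
def hull (ν : OmegaOne) (β : A) : Set A :=
  c (insert β (ρ '' Set.Iio ν))

/-- The hull of `β` at `ν` contains only the first `ν` points of the range of `ρ`. -/
def IsGoodLevel (ν : OmegaOne) (β : A) : Prop :=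
  ∀ w, ρ w ∈ hull c ρ ν β → w < ν

variable {c ρ}

theorem mem_hull (ν : OmegaOne) (β : A) : β ∈ hull c ρ ν β :=
  c.le_closure _ (Set.mem_insert _ _)

theorem mem_hull_of_lt {ν w : OmegaOne} (h : w < ν) (β : A) : ρ w ∈ hull c ρ ν β :=
  c.le_closure _ (Set.mem_insert_of_mem _ ⟨w, h, rfl⟩)

theorem hull_mono {ν ν' : OmegaOne} (h : ν ≤ ν') (β : A) : hull c ρ ν β ⊆ hull c ρ ν' β :=
  c.monotone (Set.insert_subset_insert (Set.image_mono (Set.Iio_subset_Iio h)))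

theorem closure_subset_hull {X : Set A} {ν : OmegaOne} {β : A} (h : X ⊆ hull c ρ ν β) :
    c X ⊆ hull c ρ ν β := by
  simpa [hull] using c.monotone h

theorem hull_subset_hull {ν : OmegaOne} {β γ : A} (h : β ∈ hull c ρ ν γ) :
    hull c ρ ν β ⊆ hull c ρ ν γ := by
  refine closure_subset_hull (Set.insert_subset h ?_)
  rintro _ ⟨w, hw, rfl⟩
  exact mem_hull_of_lt hw γ

theorem IsGoodLevel.of_mem {ν : OmegaOne} {β γ : A} (hγ : IsGoodLevel c ρ ν γ)
    (h : β ∈ hull c ρ ν γ) : IsGoodLevel c ρ ν β :=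
  fun w hw => hγ w (hull_subset_hull h hw)

variable {R : Set A} {f g : A → A → A}

theorem IsChangClosure.countable_hull (hc : IsChangClosure R f g c) (ν : OmegaOne) (β : A) :
    (hull c ρ ν β).Countable :=
  hc.countable _ (((OmegaOne.countable_Iio ν).image ρ).insert β)

/-- A closing-off argument: hulls are countable, so a level can be raised above every index in its
hull. After `ω` rounds the supremum is good, because by finitarity each element of its hull appears
in the hull at an earlier round. -/
theorem IsChangClosure.exists_isGoodLevel (hc : IsChangClosure R f g c)
    (hρ : Function.Injective ρ) (w : OmegaOne) (β : A) :
    ∃ ν, w < ν ∧ IsGoodLevel c ρ ν β := by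
  have hstep : ∀ ν, ∃ ν', ν < ν' ∧ ∀ w, ρ w ∈ hull c ρ ν β → w < ν' := by
    intro ν
    obtain ⟨b, hb⟩ := OmegaOne.exists_forall_lt
      ((((hc.countable_hull ν β).preimage hρ).insert ν))
    exact ⟨b, hb ν (Set.mem_insert _ _), fun w hw => hb w (Set.mem_insert_of_mem _ hw)⟩
  choose s hs hs' using hstep
  let u : ℕ → OmegaOne := fun n => s^[n] w
  have hu : ∀ n, u (n + 1) = s (u n) := fun n => Function.iterate_succ_apply' s n w
  have hmono : StrictMono u := strictMono_nat_of_lt_succ fun n => hu n ▸ hs _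
  obtain ⟨b, hb⟩ := OmegaOne.exists_forall_lt (Set.countable_range u)
  obtain ⟨ν, hν, hmin⟩ := WellFounded.has_min (wellFounded_lt (α := OmegaOne))
    {b | ∀ n, u n < b} ⟨b, fun n => hb _ ⟨n, rfl⟩⟩
  have hlim : ∀ x < ν, ∃ n, x ≤ u n := by
    intro x hx
    by_contra! h
    exact hmin x h hx
  refine ⟨ν, hν 0, fun x hx => ?_⟩
  obtain ⟨F, hF, hFs, hxF⟩ := hc.finitary _ _ hx
  have hn : ∃ n, F ⊆ insert β (ρ '' Set.Iio (u n)) := by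
    have : ∀ y ∈ F, ∃ n, y ∈ insert β (ρ '' Set.Iio (u n)) := by
      intro y hy
      obtain rfl | ⟨z, hz, rfl⟩ := hFs hy
      · exact ⟨0, Set.mem_insert _ _⟩
      · obtain ⟨n, hn⟩ := hlim z hz
        exact ⟨n + 1, Set.mem_insert_of_mem _ ⟨z, hn.trans_lt (hmono n.lt_succ_self), rfl⟩⟩
    choose! k hk using this
    obtain ⟨N, hN⟩ := (hF.image k).bddAbove
    refine ⟨N, fun y hy => ?_⟩
    exact Set.insert_subset_insert (Set.image_mono (Set.Iio_subset_Iio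
      (hmono.monotone (hN ⟨y, hy, rfl⟩)))) (hk y hy)
  obtain ⟨n, hn⟩ := hn
  calc x < u (n + 1) := hu n ▸ hs' _ x (c.monotone hn hxF)
    _ < ν := hν _

end Hull

/-- The color `e a b` is the least good level at which the hull of `b` contains `a`. Closure is
taken under the map sending `b` and `a < b` to the code `ρ (i b a)` of `a`, and under the inverse
decoding `g`. -/
theorem exists_isUnboundedColoring (hCC : ¬ ChangsConjecture) :
    ∃ (A : Type) (_ : LinearOrder A) (e : A → A → OmegaOne), #A = ℵ_ 2 ∧
      IsUnboundedColoring e := by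
  classical
  obtain ⟨A, R, hA, hR, hc⟩ := exists_isChangClosure_of_not_changsConjecture hCC
  obtain ⟨o, hIio⟩ := exists_linearOrder_mk_Iio_le hA
  obtain ⟨E⟩ := Cardinal.eq.1 (OmegaOne.mk_eq.trans hR.symm)
  let ρ : OmegaOne → A := fun w => E w
  have hρ : Function.Injective ρ := Subtype.val_injective.comp E.injective
  have hRρ : ∀ x ∈ R, ∃ w, ρ w = x := fun x hx => ⟨E.symm ⟨x, hx⟩, by simp [ρ]⟩
  have henum : ∀ b : A, ∃ i : A → OmegaOne, Set.InjOn i (Set.Iio b) := by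
    intro b
    have h : #(Set.Iio b) ≤ #OmegaOne := (hIio b).trans OmegaOne.mk_eq.ge
    obtain ⟨i⟩ := h
    have : Nonempty OmegaOne := mk_ne_zero_iff.1 (by rw [OmegaOne.mk_eq]; exact (aleph_pos 1).ne')
    refine ⟨fun a => if h : a < b then i ⟨a, h⟩ else Classical.arbitrary _, fun x hx y hy h => ?_⟩
    simp only [dif_pos hx.out, dif_pos hy.out] at h
    exact congrArg Subtype.val (i.injective h)
  choose i hi using henum
  have hdec : ∃ g : A → A → A, ∀ b, ∀ a < b, g b (ρ (i b a)) = a := by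
    refine ⟨fun b x => if h : ∃ a, a < b ∧ ρ (i b a) = x then h.choose else b, fun b a hab => ?_⟩
    have h : ∃ a', a' < b ∧ ρ (i b a') = ρ (i b a) := ⟨a, hab, rfl⟩
    simp only [dif_pos h]
    exact hi b h.choose_spec.1 hab (hρ h.choose_spec.2)
  obtain ⟨g, hg⟩ := hdec
  obtain ⟨c, hc⟩ := hc (fun b a => ρ (i b a)) g
  have hmem : ∀ b, ∀ a < b, ∃ ν, IsGoodLevel c ρ ν b ∧ a ∈ hull c ρ ν b := by
    intro b a hab
    obtain ⟨ν, hν, hgood⟩ := hc.exists_isGoodLevel hρ (i b a) b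
    refine ⟨ν, hgood, ?_⟩
    have := (hc.closed _ b (mem_hull (ρ := ρ) ν b) _ (mem_hull_of_lt hν b)).2
    rwa [hg b a hab] at this
  have hmin : ∃ e : A → A → OmegaOne, ∀ b, ∀ a < b,
      (IsGoodLevel c ρ (e a b) b ∧ a ∈ hull c ρ (e a b) b) ∧
        ∀ ν, IsGoodLevel c ρ ν b → a ∈ hull c ρ ν b → e a b ≤ ν := by
    have : ∀ a b, ∃ e, a < b → (IsGoodLevel c ρ e b ∧ a ∈ hull c ρ e b) ∧
        ∀ ν, IsGoodLevel c ρ ν b → a ∈ hull c ρ ν b → e ≤ ν := by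
      intro a b
      by_cases hab : a < b
      · obtain ⟨ν, hν, hν'⟩ := WellFounded.has_min (wellFounded_lt (α := OmegaOne)) _ (hmem b a hab)
        exact ⟨ν, fun _ => ⟨hν, fun x h1 h2 => not_lt.1 (hν' x ⟨h1, h2⟩)⟩⟩
      · exact ⟨i a b, fun h => absurd h hab⟩
    choose e he using this
    exact ⟨e, fun b a => he a b⟩
  obtain ⟨e, he⟩ := hmin
  refine ⟨A, o, e, hA, fun a b d hab hbd => ?_, fun b ν => ?_, fun Y hY ν => ?_⟩
  · have hgood : IsGoodLevel c ρ (max (e a d) (e b d)) d := by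
      obtain h | h := max_choice (e a d) (e b d) <;> rw [h]
      exacts [(he d a (hab.trans hbd)).1.1, (he d b hbd).1.1]
    have ha : a ∈ hull c ρ (max (e a d) (e b d)) d :=
      hull_mono (le_max_left _ _) d (he d a (hab.trans hbd)).1.2
    have hb : b ∈ hull c ρ (max (e a d) (e b d)) d :=
      hull_mono (le_max_right _ _) d (he d b hbd).1.2
    refine (he b a hab).2 _ (hgood.of_mem hb) ?_
    -- The code of `a` below `b` lies in a good hull of `d`, hence is below the level. The hull of
    -- `b` alone therefore contains this code and can decode `a`.
    have hlt := hgood _ (hc.closed _ b hb a ha).1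
    have := (hc.closed _ b (mem_hull (ρ := ρ) _ b) _ (mem_hull_of_lt hlt b)).2
    rwa [hg b a hab] at this
  · refine (hc.countable_hull (ρ := ρ) ν b).mono ?_
    rintro a ⟨hab, hle⟩
    exact hull_mono hle b (he b a hab).1.2
  · by_contra! hbdd
    refine hc.uncountable Y hY (((OmegaOne.countable_Iio ν).image ρ).mono ?_)
    rintro x ⟨hx, hxR⟩
    obtain ⟨w, rfl⟩ := hRρ x hxR
    refine ⟨w, ?_, rfl⟩
    -- If colors on `Y` are at most `ν`, every finite part of `Y` lies in a good hull of its maximum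
    -- at a level at most `ν`. Two points of `Y` are added to `F` so that some color is available.
    obtain ⟨F, hF, hFY, hwF⟩ := hc.finitary _ _ hx
    obtain ⟨p, hp, q, hq, hpq⟩ : Y.Nontrivial := by
      by_contra h
      exact hY (Set.not_nontrivial_iff.1 h).countable
    let G : Finset A := hF.toFinset ∪ {p, q}
    have hGY : ∀ a ∈ G, a ∈ Y := by
      intro a ha
      simp only [G, Finset.mem_union, Set.Finite.mem_toFinset, Finset.mem_insert,
        Finset.mem_singleton] at ha
      rcases ha with h | rfl | rfl
      exacts [hFY h, hp, hq]
    have hFG : ∀ a ∈ F, a ∈ G := fun a ha => by simp [G, ha]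
    have hpG : p ∈ G := by simp [G]
    have hqG : q ∈ G := by simp [G]
    obtain ⟨m, hm, hmax⟩ := G.exists_max_image id ⟨p, hpG⟩
    simp only [id] at hmax
    have hne : (G.erase m).Nonempty := by
      by_cases h : p = m
      · exact ⟨q, Finset.mem_erase.2 ⟨fun h' => hpq (h.trans h'.symm), hqG⟩⟩
      · exact ⟨p, Finset.mem_erase.2 ⟨h, hpG⟩⟩
    have hlt : ∀ a ∈ G.erase m, a < m := fun a ha =>
      lt_of_le_of_ne (hmax a (Finset.mem_of_mem_erase ha)) (Finset.ne_of_mem_erase ha)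
    obtain ⟨a₀, ha₀, hmax₀⟩ := (G.erase m).exists_max_image (fun a => e a m) hne
    have hsub : F ⊆ hull c ρ (e a₀ m) m := by
      intro a ha
      by_cases h : a = m
      · exact h ▸ mem_hull _ _
      · have ha' : a ∈ G.erase m := Finset.mem_erase.2 ⟨h, hFG a ha⟩
        exact hull_mono (hmax₀ a ha') m (he m a (hlt a ha')).1.2
    have := (he m a₀ (hlt a₀ ha₀)).1.1 w (closure_subset_hull hsub hwF)
    exact this.trans_le (hbdd a₀ (hGY _ (Finset.mem_of_mem_erase ha₀)) m (hGY _ hm) (hlt a₀ ha₀))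

/-! ### Uncountable families of finite sets -/

theorem Set.exists_not_countable_fiber {I K : Type*} {S : Set I} (hS : ¬ S.Countable) (f : I → K)
    (hf : (f '' S).Countable) : ∃ k, ¬ {i ∈ S | f i = k}.Countable := by
  by_contra! h
  refine hS ((hf.biUnion fun k _ => h k).mono fun i hi => ?_)
  simp only [Set.mem_iUnion]
  exact ⟨f i, Set.mem_image_of_mem f hi, hi, rfl⟩

theorem Set.exists_maximal_pairwise {I : Type*} (S : Set I) (r : I → I → Prop) :
    ∃ T, Maximal (fun T : Set I => T ⊆ S ∧ T.Pairwise r) T := by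
  obtain ⟨T, hT⟩ := zorn_subset {T : Set I | T ⊆ S ∧ T.Pairwise r} fun c hc hchain =>
    ⟨⋃₀ c, ⟨Set.sUnion_subset fun t ht => (hc ht).1,
      hchain.pairwise_sUnion.2 fun t ht => (hc ht).2⟩, fun t ht => Set.subset_sUnion_of_mem ht⟩
  exact ⟨T, hT⟩

/-- A point in uncountably many of the sets is removed and the induction hypothesis applied.
Otherwise a maximal disjoint subfamily is uncountable: a countable one would have a countable union
met by every set, while each point lies in only countably many sets. -/
theorem Finset.exists_deltaSystem_of_card_eq {I A : Type*} [DecidableEq A] (n : ℕ) :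
    ∀ (x : I → Finset A) (S : Set I), ¬ S.Countable → (∀ i ∈ S, (x i).card = n) →
      ∃ T ⊆ S, ¬ T.Countable ∧ ∃ r, T.Pairwise fun i j => x i ∩ x j = r := by
  induction n with
  | zero =>
    intro x S hS hx
    refine ⟨S, subset_rfl, hS, ∅, fun i hi j _ _ => ?_⟩
    simp [Finset.card_eq_zero.1 (hx i hi)]
  | succ n ih =>
    intro x S hS hx
    by_cases h : ∃ a, ¬ {i ∈ S | a ∈ x i}.Countable
    · obtain ⟨a, ha⟩ := h
      obtain ⟨T, hTS, hT, r, hr⟩ := ih (fun i => (x i).erase a) _ ha (by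
        rintro i ⟨hi, hai⟩
        rw [Finset.card_erase_of_mem hai, hx i hi, Nat.add_sub_cancel])
      refine ⟨T, hTS.trans (Set.sep_subset _ _), hT, insert a r, fun i hi j hj hij => ?_⟩
      rw [← hr hi hj hij, ← Finset.insert_erase (hTS hi).2, ← Finset.insert_erase (hTS hj).2]
      ext b
      by_cases hb : b = a
      · simpa [hb] using ⟨(hTS hi).2, (hTS hj).2⟩
      · simp [hb]
    · push Not at h
      obtain ⟨T, hT⟩ := Set.exists_maximal_pairwise S fun i j => x i ∩ x j = ∅
      refine ⟨T, hT.prop.1, fun hTc => hS ?_, ∅, hT.prop.2⟩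
      have hc : (⋃ i ∈ T, (x i : Set A)).Countable :=
        hTc.biUnion fun i _ => (x i).countable_toSet
      refine (hc.biUnion fun a _ => h a).mono fun i hi => ?_
      suffices ∃ j ∈ T, (x i ∩ x j).Nonempty by
        obtain ⟨j, hj, a, ha⟩ := this
        simp only [Set.mem_iUnion]
        rw [Finset.mem_inter] at ha
        exact ⟨a, ⟨j, hj, ha.2⟩, hi, ha.1⟩
      by_contra! hdisj
      have hins : insert i T ⊆ S ∧ (insert i T).Pairwise fun i j => x i ∩ x j = ∅ := by
        refine ⟨Set.insert_subset hi hT.prop.1, hT.prop.2.insert fun j hj _ => ⟨?_, ?_⟩⟩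
        · exact hdisj j hj
        · rw [Finset.inter_comm]
          exact hdisj j hj
      have hiT : i ∈ T := hT.le_of_ge hins (Set.subset_insert i T) (Set.mem_insert i T)
      have := hdisj i hiT
      rw [Finset.inter_self] at this
      have hcard := hx i hi
      simp [this] at hcard

/-- The `Δ`-system lemma: an uncountable family of finite sets has an uncountable subfamily in which
any two members have the same intersection. -/
theorem Finset.exists_deltaSystem {I A : Type*} [DecidableEq A] (x : I → Finset A) {S : Set I}
    (hS : ¬ S.Countable) :
    ∃ T ⊆ S, ¬ T.Countable ∧ ∃ r, T.Pairwise fun i j => x i ∩ x j = r := by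
  obtain ⟨n, hn⟩ := Set.exists_not_countable_fiber hS (fun i => (x i).card) (Set.to_countable _)
  obtain ⟨T, hTS, hT⟩ := Finset.exists_deltaSystem_of_card_eq n x _ hn fun i hi => hi.2
  exact ⟨T, hTS.trans (Set.sep_subset _ _), hT⟩

theorem exists_ultrafilter_notMem_of_countable {I : Type*} {S : Set I} (hS : ¬ S.Countable) :
    ∃ U : Ultrafilter I, S ∈ U ∧ ∀ C : Set I, (S ∩ C).Countable → ∀ᶠ i in U, i ∉ C := by
  have : (Filter.cocountable ⊓ Filter.principal S).NeBot := by
    rw [Filter.inf_principal_neBot_iff]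
    intro V hV
    by_contra h
    exact hS ((Filter.mem_cocountable.1 hV).mono fun i hi => fun hiV => h ⟨i, hiV, hi⟩)
  have hle := Ultrafilter.of_le (Filter.cocountable ⊓ Filter.principal S)
  refine ⟨Ultrafilter.of (Filter.cocountable ⊓ Filter.principal S), ?_, fun C hC => ?_⟩
  · exact hle (Filter.mem_inf_of_right (Filter.mem_principal_self S))
  · have h1 : (S ∩ C)ᶜ ∈ Filter.cocountable ⊓ Filter.principal S :=
      Filter.mem_inf_of_left (Filter.mem_cocountable.2 (by rwa [compl_compl]))
    have h2 : S ∈ Filter.cocountable ⊓ Filter.principal S :=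
      Filter.mem_inf_of_right (Filter.mem_principal_self S)
    filter_upwards [hle h1, hle h2] with i hi hiS hiC using hi ⟨hiS, hiC⟩

/-- In an uncountable family of pairwise disjoint finite sets there are two members such that an
unbounded coloring takes only large values on their product. -/
theorem IsUnboundedColoring.exists_forall_lt {A : Type} [LinearOrder A] {e : A → A → OmegaOne}
    (he : IsUnboundedColoring e) {I : Type*} {S : Set I} (hS : ¬ S.Countable) (x : I → Finset A)
    (hx : S.Pairwise fun i j => Disjoint (x i) (x j)) (ν : OmegaOne) :
    ∃ i ∈ S, ∃ j ∈ S, i ≠ j ∧ ∀ a ∈ x i, ∀ b ∈ x j, ν < e (min a b) (max a b) := by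
  by_contra! hbad
  obtain ⟨k, hk⟩ := Set.exists_not_countable_fiber hS (fun i => (x i).card) (Set.to_countable _)
  set T := {i ∈ S | (x i).card = k}
  have hTne : T.Nonempty := by
    by_contra h
    exact hk (Set.not_nonempty_iff_eq_empty.1 h ▸ Set.countable_empty)
  have hy : ∀ i, ∃ y : Fin k → A, i ∈ T → ∀ a, a ∈ x i ↔ ∃ t, y t = a := by
    intro i
    by_cases hi : i ∈ T
    · let E := (x i).equivFinOfCardEq hi.2
      refine ⟨fun t => E.symm t, fun _ a => ⟨fun ha => ⟨E ⟨a, ha⟩, by simp⟩, ?_⟩⟩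
      rintro ⟨t, rfl⟩
      exact (E.symm t).2
    · have : Nonempty (Fin k → A) := by
        obtain ⟨j, hj⟩ := hTne
        exact ⟨fun t => ((x j).equivFinOfCardEq hj.2).symm t⟩
      exact ⟨Classical.arbitrary _, fun h => absurd h hi⟩
  choose y hy using hy
  have hymem : ∀ i ∈ T, ∀ t, y i t ∈ x i := fun i hi t => (hy i hi _).2 ⟨t, rfl⟩
  have hinj : ∀ s t, ∀ i ∈ T, ∀ j ∈ T, y i s = y j t → i = j := by
    intro s t i hi j hj h
    by_contra hij
    exact Finset.disjoint_left.1 (hx hi.1 hj.1 hij) (hymem i hi s) (h ▸ hymem j hj t)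
  -- For fixed `i`, each other `j` has a bad pair of positions. As there are finitely many pairs,
  -- one of them is bad for `U`-almost all `j`.
  obtain ⟨U, hTU, hU⟩ := exists_ultrafilter_notMem_of_countable hk
  have hpair : ∀ i, ∃ p : Fin k × Fin k, i ∈ T →
      ∀ᶠ j in U, e (min (y i p.1) (y j p.2)) (max (y i p.1) (y j p.2)) ≤ ν := by
    intro i
    by_cases hi : i ∈ T
    · have : ∀ᶠ j in U, ∃ p : Fin k × Fin k,
          e (min (y i p.1) (y j p.2)) (max (y i p.1) (y j p.2)) ≤ ν := by
        filter_upwards [hTU, hU {i} ((Set.countable_singleton i).mono Set.inter_subset_right)]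
          with j hj hij
        obtain ⟨a, ha, b, hb, hab⟩ := hbad i hi.1 j hj.1 fun h => hij h.symm
        obtain ⟨s, rfl⟩ := (hy i hi a).1 ha
        obtain ⟨t, rfl⟩ := (hy j hj b).1 hb
        exact ⟨(s, t), hab⟩
      obtain ⟨p, hp⟩ := Ultrafilter.eventually_exists_iff.1 this
      exact ⟨p, fun _ => hp⟩
    · obtain ⟨j, hj⟩ := hTne
      have hne : (x j).Nonempty := by
        obtain ⟨j', hj', hne⟩ : ∃ j' ∈ T, j' ≠ j := by
          by_contra! h
          exact hk ((Set.countable_singleton j).mono h)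
        obtain ⟨a, ha, -⟩ := hbad j hj.1 j' hj'.1 hne.symm
        exact ⟨a, ha⟩
      have hkpos : 0 < k := hj.2 ▸ hne.card_pos
      exact ⟨(⟨0, hkpos⟩, ⟨0, hkpos⟩), fun h => absurd h hi⟩
  choose p hp using hpair
  obtain ⟨q, hq⟩ := Set.exists_not_countable_fiber hk p (Set.to_countable _)
  have hY : ¬ ((fun i => y i q.1) '' {i ∈ T | p i = q}).Countable := by
    intro h
    refine hq (Set.countable_of_injective_of_countable_image ?_ h)
    exact fun i hi j hj hij => hinj _ _ i hi.1 j hj.1 hij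
  obtain ⟨_, ⟨i, ⟨hi, hpi⟩, rfl⟩, _, ⟨j, ⟨hj, hpj⟩, rfl⟩, hlt, hν⟩ := he.unbounded _ hY ν
  have hpi' := hpi ▸ hp i hi
  have hpj' := hpj ▸ hp j hj
  -- Local countability: for all but countably many `l`, a point `y l q.2` below `y j q.1` would get
  -- a color above `ν`. Hence a `U`-typical `l` has `y l q.2` above `y j q.1`, and subadditivity
  -- bounds the color of the earlier pair by `ν`.
  have hC : (T ∩ {l | y l q.2 ∈ insert (y j q.1) {a | a < y j q.1 ∧ e a (y j q.1) ≤ ν}}).Countable := by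
    refine Set.countable_of_injective_of_countable_image (f := fun l => y l q.2)
      (fun l hl l' hl' h => hinj _ _ l hl.1 l' hl'.1 h) ?_
    refine ((he.countable (y j q.1) ν).insert (y j q.1)).mono ?_
    rintro _ ⟨l, hl, rfl⟩
    exact hl.2
  obtain ⟨l, ⟨h1, h2⟩, h3⟩ := ((hpi'.and hpj').and (hU _ hC)).exists
  simp only [Set.mem_ofPred_eq, Set.mem_insert_iff, not_or, not_and, not_le] at h3
  have hjl : y j q.1 < y l q.2 := by
    by_contra h
    have hlt' := lt_of_le_of_ne (not_lt.1 h) h3.1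
    rw [min_eq_right hlt'.le, max_eq_left hlt'.le] at h2
    exact (h3.2 hlt').not_ge h2
  rw [min_eq_left hjl.le, max_eq_right hjl.le] at h2
  rw [min_eq_left (hlt.trans hjl).le, max_eq_right (hlt.trans hjl).le] at h1
  exact hν.not_ge ((he.le_max _ _ _ hlt hjl).trans (max_le h1 h2))

/-! ### The forcing and its chain condition -/

section Forcing

variable {A : Type} [LinearOrder A] (e : A → A → OmegaOne)

/-- Compatibility of two values of a coloring of `A × ω₁`: there is only one value at each point,
and the rows `a ≠ b` agree only at columns bounded by the color of `{a, b}`. -/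
def IsAgreeable (x y : A × OmegaOne × ℕ) : Prop :=
  x.2.1 = y.2.1 → (x.1 = y.1 → x.2.2 = y.2.2) ∧
    (x.1 ≠ y.1 → x.2.2 = y.2.2 → x.2.1 ≤ e (min x.1 y.1) (max x.1 y.1))

/-- The forcing notion of finite approximations to a coloring of `A × ω₁` whose rows are almost
disjoint. -/
abbrev AlmostDisjointForcing : Type :=
  {p : Finset (A × OmegaOne × ℕ) // ∀ x ∈ p, ∀ y ∈ p, IsAgreeable e x y}

variable {e}

theorem IsAgreeable.symm {x y : A × OmegaOne × ℕ} (h : IsAgreeable e x y) :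
    IsAgreeable e y x := by
  intro hxy
  refine ⟨fun h1 => ((h hxy.symm).1 h1.symm).symm, fun h1 h2 => ?_⟩
  have := (h hxy.symm).2 h1.symm h2.symm
  rwa [hxy, min_comm, max_comm]

theorem AlmostDisjointForcing.compatible_of_agreeable {p q : AlmostDisjointForcing e}
    (h : ∀ x ∈ p.1, ∀ y ∈ q.1, IsAgreeable e x y) : ForcingCompatible p q := by
  classical
  refine ⟨⟨p.1 ∪ q.1, fun x hx y hy => ?_⟩, Finset.subset_union_left, Finset.subset_union_right⟩
  rcases Finset.mem_union.1 hx with hx | hx <;> rcases Finset.mem_union.1 hy with hy | hy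
  exacts [p.2 x hx y hy, h x hx y hy, (h y hy x hx).symm, q.2 x hx y hy]

/-- Rows and columns are thinned to `Δ`-systems with roots `r₁` and `r₂`, and the conditions to a
common part on `r₁ × r₂`. Two conditions share columns only in `r₂`, below some `ν`, so agreements
there between rows off the root are harmless once the colors exceed `ν`. -/
theorem AlmostDisjointForcing.countableChainCondition (he : IsUnboundedColoring e) :
    CountableChainCondition (AlmostDisjointForcing e) := by
  classical
  intro S hS
  by_contra hSc
  obtain ⟨T₁, hT₁S, hT₁, r₁, hr₁⟩ := Finset.exists_deltaSystem
    (fun p : AlmostDisjointForcing e => p.1.image fun x => x.1) hSc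
  obtain ⟨T₂, hT₂T₁, hT₂, r₂, hr₂⟩ := Finset.exists_deltaSystem
    (fun p : AlmostDisjointForcing e => p.1.image fun x => x.2.1) hT₁
  obtain ⟨s, hs⟩ := Set.exists_not_countable_fiber hT₂
    -- The roots are finite and values are natural numbers, so only countably many traces are
    -- possible.
    (fun p : AlmostDisjointForcing e => p.1.filter fun x => x.1 ∈ r₁ ∧ x.2.1 ∈ r₂) (by
      have hD : {x : A × OmegaOne × ℕ | x.1 ∈ r₁ ∧ x.2.1 ∈ r₂}.Countable := by
        refine (r₁.countable_toSet.prod (r₂.countable_toSet.prod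
          (Set.countable_univ (α := ℕ)))).mono ?_
        rintro x ⟨h1, h2⟩
        exact ⟨h1, h2, trivial⟩
      refine Set.countable_of_injective_of_countable_image
        (f := fun F : Finset (A × OmegaOne × ℕ) => (F : Set (A × OmegaOne × ℕ)))
        Finset.coe_injective.injOn ((Set.countable_ofPred_finite_subset hD).mono ?_)
      rintro _ ⟨_, ⟨p, hp, rfl⟩, rfl⟩
      refine ⟨Finset.finite_toSet _, fun x hx => ?_⟩
      exact (Finset.mem_filter.1 (Finset.mem_coe.1 hx)).2)
  obtain ⟨ν, hν⟩ := OmegaOne.exists_forall_lt r₂.countable_toSet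
  have hsub : {p ∈ T₂ | (p.1.filter fun x => x.1 ∈ r₁ ∧ x.2.1 ∈ r₂) = s} ⊆ T₁ :=
    (Set.sep_subset _ _).trans hT₂T₁
  obtain ⟨p, hp, q, hq, hpq, hlt⟩ := he.exists_forall_lt hs
    (fun p : AlmostDisjointForcing e => (p.1.image fun x => x.1) \ r₁) (by
      intro p hp q hq hpq
      rw [Finset.disjoint_left]
      intro a ha hb
      rw [Finset.mem_sdiff] at ha hb
      exact ha.2 (hr₁ (hsub hp) (hsub hq) hpq ▸ Finset.mem_inter.2 ⟨ha.1, hb.1⟩)) ν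
  refine hS (hT₁S (hsub hp)) (hT₁S (hsub hq)) hpq
    (AlmostDisjointForcing.compatible_of_agreeable fun x hx y hy hxy => ?_)
  have hx₂ : x.2.1 ∈ r₂ := by
    rw [← hr₂ hp.1 hq.1 hpq, Finset.mem_inter]
    exact ⟨Finset.mem_image_of_mem _ hx, hxy ▸ Finset.mem_image_of_mem _ hy⟩
  have hx₁ : x.1 ∈ p.1.image fun x => x.1 := Finset.mem_image_of_mem (fun x => x.1) hx
  have hy₁ : y.1 ∈ q.1.image fun x => x.1 := Finset.mem_image_of_mem (fun x => x.1) hy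
  by_cases hxr : x.1 ∈ r₁
  · have hxs : x ∈ s := hp.2 ▸ Finset.mem_filter.2 ⟨hx, hxr, hx₂⟩
    rw [← hq.2] at hxs
    exact q.2 x (Finset.mem_filter.1 hxs).1 y hy hxy
  by_cases hyr : y.1 ∈ r₁
  · have hys : y ∈ s := hq.2 ▸ Finset.mem_filter.2 ⟨hy, hyr, hxy ▸ hx₂⟩
    rw [← hp.2] at hys
    exact p.2 x hx y (Finset.mem_filter.1 hys).1 hxy
  refine ⟨fun h => absurd ?_ hxr, fun _ _ => ?_⟩
  · rw [← hr₁ (hsub hp) (hsub hq) hpq]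
    exact Finset.mem_inter.2 ⟨hx₁, h ▸ hy₁⟩
  · exact (hν _ hx₂).le.trans
      (hlt _ (Finset.mem_sdiff.2 ⟨hx₁, hxr⟩) _ (Finset.mem_sdiff.2 ⟨hy₁, hyr⟩)).le

theorem AlmostDisjointForcing.isCofinal_exists_mem (a : A) (ξ : OmegaOne) :
    IsCofinal {p : AlmostDisjointForcing e | ∃ m, (a, ξ, m) ∈ p.1} := by
  classical
  intro p
  by_cases h : ∃ m, (a, ξ, m) ∈ p.1
  · exact ⟨p, h, le_rfl⟩
  push Not at h
  -- A value unused in `p` creates no new agreement between rows.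
  obtain ⟨m, hm⟩ := Infinite.exists_notMem_finset (p.1.image fun x => x.2.2)
  have hfresh : ∀ y ∈ p.1, IsAgreeable e (a, ξ, m) y := by
    rintro ⟨b, η, n⟩ hy hξ
    have hmn : m ≠ n := fun hmn => hm (Finset.mem_image.2 ⟨_, hy, hmn.symm⟩)
    refine ⟨?_, fun _ hmn' => absurd hmn' hmn⟩
    intro hab
    simp only at hab hξ
    subst hab hξ
    exact absurd hy (h n)
  refine ⟨⟨insert (a, ξ, m) p.1, fun x hx y hy => ?_⟩, ⟨m, Finset.mem_insert_self _ _⟩,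
    Finset.subset_insert _ _⟩
  rcases Finset.mem_insert.1 hx with rfl | hx <;> rcases Finset.mem_insert.1 hy with rfl | hy
  exacts [fun _ => ⟨fun _ => rfl, fun h => absurd rfl h⟩, hfresh y hy, (hfresh x hx).symm,
    p.2 x hx y hy]

end Forcing

/-- Under Martin's axiom for `ℵ₂` dense sets and the failure of Chang's conjecture there are `ℵ₂`
functions from `ω₁` to `ω` any two of which agree at only countably many points. -/
theorem exists_almostDisjoint_functions (hMA : MartinsAxiom)
    (hc : ℵ_ 2 < (2 : Cardinal.{0}) ^ ℵ₀) (hCC : ¬ ChangsConjecture) :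
    ∃ (A : Type) (F : A → OmegaOne → ℕ), #A = ℵ_ 2 ∧
      ∀ a b, a ≠ b → {ξ | F a ξ = F b ξ}.Countable := by
  obtain ⟨A, _, e, hA, he⟩ := exists_isUnboundedColoring hCC
  have : Nonempty (AlmostDisjointForcing e) := ⟨⟨∅, by simp⟩⟩
  have hcard : #(A × OmegaOne) < 2 ^ ℵ₀ := by
    rw [mk_prod, Cardinal.lift_id, Cardinal.lift_id, hA, OmegaOne.mk_eq]
    refine (mul_le_of_le (aleph0_le_aleph 2) le_rfl ?_).trans_lt hc
    exact aleph_le_aleph.2 (by norm_num)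
  obtain ⟨G, hG⟩ := hMA (AlmostDisjointForcing e)
    (AlmostDisjointForcing.countableChainCondition he) (A × OmegaOne)
    (fun i => {p | ∃ m, (i.1, i.2, m) ∈ p.1}) hcard
    fun i => AlmostDisjointForcing.isCofinal_exists_mem i.1 i.2
  have hF : ∀ a ξ, ∃ m, ∃ p ∈ G, (a, ξ, m) ∈ p.1 := by
    intro a ξ
    obtain ⟨p, hp, m, hm⟩ := hG (a, ξ)
    exact ⟨m, p, hp, hm⟩
  choose F hF using hF
  refine ⟨A, F, hA, fun a b hab => (OmegaOne.countable_Iic (e (min a b) (max a b))).mono ?_⟩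
  intro ξ hξ
  obtain ⟨p, hp, hap⟩ := hF a ξ
  obtain ⟨q, hq, hbq⟩ := hF b ξ
  obtain ⟨r, -, hpr, hqr⟩ := G.directed p hp q hq
  exact (r.2 _ (hpr hap) _ (hqr hbq) rfl).2 hab hξ

/-! ### Almost disjoint functions against weakly Laver ideals -/

theorem aleph_two_eq_succ_succ : ℵ_ (2 : Ordinal.{0}) = Order.succ (Order.succ ℵ₀) := by
  rw [succ_aleph0, succ_aleph]
  norm_num

theorem IsCompleteIdeal.exists_fiber_notMem {X : Type} {I : Order.Ideal (Set X)}
    (hI : IsCompleteIdeal (Order.succ ℵ₀) I) (hproper : I.IsProper) (f : X → ℕ) :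
    ∃ n, f ⁻¹' {n} ∉ I := by
  by_contra! h
  refine hproper.top_notMem (I.lower ?_ (hI (Set.range fun n => f ⁻¹' {n}) ?_ ?_))
  · exact fun x _ => ⟨_, ⟨f x, rfl⟩, rfl⟩
  · rw [Order.lt_succ_iff, le_aleph0_iff_set_countable]
    exact Set.countable_range _
  · rintro _ ⟨n, rfl⟩
    exact h n

theorem exists_fiber_mk_eq_aleph_two {A : Type} (hA : #A = ℵ_ 2) (n : A → ℕ) :
    ∃ k, #{a | n a = k} = ℵ_ 2 := by
  have hreg : (ℵ_ (2 : Ordinal.{0})).IsRegular := by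
    rw [aleph_two_eq_succ_succ]
    exact isRegular_succ (Order.le_succ _)
  obtain ⟨k, hk⟩ := infinite_pigeonhole_card n (ℵ_ 2) hA.ge hreg.aleph0_le (by
    rw [hreg.cof_ord, mk_nat]
    exact aleph0_lt_aleph.2 (by norm_num))
  exact ⟨k, le_antisymm ((mk_set_le _).trans hA.le) hk⟩

theorem not_isWeaklyLaver_of_almostDisjoint {A : Type} (hA : #A = ℵ_ 2) (F : A → OmegaOne → ℕ)
    (hF : ∀ a b, a ≠ b → {ξ | F a ξ = F b ξ}.Countable) (I : Order.Ideal (Set OmegaOne)) :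
    ¬ IsWeaklyLaver ℵ₀ I := by
  intro hI
  choose n hn using fun a => hI.complete.exists_fiber_notMem hI.proper (F a)
  obtain ⟨k, hk⟩ := exists_fiber_mk_eq_aleph_two hA n
  obtain ⟨J, hJ, hJI⟩ := hI.saturated {a | n a = k} (fun a => F a ⁻¹' {n a})
    (by rw [hk, aleph_two_eq_succ_succ]) fun a => hn a
  -- Two members already meet in a countable set, but saturation speaks only of index sets of size
  -- `ℵ₀`.
  obtain ⟨C, hCJ, hC⟩ := le_mk_iff_exists_subset.1 (hJ ▸ Order.le_succ ℵ₀ : ℵ₀ ≤ #J)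
  have : Infinite C := by rw [infinite_iff, hC]
  obtain ⟨a, b, hab⟩ := exists_pair_ne C
  refine hJI C hCJ hC (hI.uniform _ ?_)
  rw [OmegaOne.mk_eq, ← succ_aleph0, Order.lt_succ_iff, mk_le_aleph0_iff]
  refine ((hF a.1.1 b.1.1 fun h => hab (Subtype.ext (Subtype.ext h))).mono fun ξ hξ => ?_).to_subtype
  simp only [Set.mem_iInter] at hξ
  have ha := hξ a.1 a.2
  have hb := hξ b.1 b.2
  simp only [Set.mem_preimage, Set.mem_singleton_iff] at ha hb
  rw [Set.mem_ofPred_eq, ha, hb, a.1.2, b.1.2]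

/-! ### The nonstationary ideal and the conclusion -/

theorem mem_nonstationaryIdeal {B : Set OmegaOne} :
    B ∈ nonstationaryIdeal ↔ ¬ IsStationary B := Iff.rfl

theorem isProper_nonstationaryIdeal : nonstationaryIdeal.IsProper := by
  have : Nonempty OmegaOne := mk_ne_zero_iff.1 (by rw [OmegaOne.mk_eq]; exact (aleph_pos 1).ne')
  exact Order.Ideal.isProper_of_notMem (p := Set.univ) (not_not.2 IsStationary.univ)

theorem isUniformIdeal_nonstationaryIdeal : IsUniformIdeal nonstationaryIdeal := by
  intro B hB
  rw [OmegaOne.mk_eq, ← succ_aleph0, Order.lt_succ_iff, le_aleph0_iff_set_countable] at hB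
  obtain ⟨b, hb⟩ := OmegaOne.exists_forall_lt hB
  rw [mem_nonstationaryIdeal, not_isStationary_iff]
  refine ⟨Set.Ici b, ⟨?_, ?_⟩, ?_⟩
  · intro t ht hne _ x hx
    obtain ⟨y, hy⟩ := hne
    exact Set.mem_Ici.2 ((ht hy).out.trans (hx.1 hy))
  · intro a
    exact ⟨max a b, Set.mem_Ici.2 (le_max_right _ _), le_max_left _ _⟩
  · rw [Set.disjoint_left]
    exact fun x hx hbx => (hb x hx).not_ge hbx

theorem isCompleteIdeal_nonstationaryIdeal :
    IsCompleteIdeal (Order.succ ℵ₀) nonstationaryIdeal := by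
  intro S hS hSN
  have hcof : Order.cof OmegaOne = ℵ₁ := by simp
  rw [mem_nonstationaryIdeal, isStationary_sUnion_iff cof_omega1_ne_aleph0
    (by rw [hcof, ← succ_aleph0]; exact hS)]
  rintro ⟨B, hB, hst⟩
  exact hSN B hB hst

theorem theorem1p2 (hMA : MartinsAxiom) (hc : ℵ_ 2 < (2 : Cardinal.{0}) ^ ℵ₀)
    (hCC : ¬ ChangsConjecture) :
    (¬ ∃ I : Order.Ideal (Set (ω₁ : Ordinal.{0}).ToType), IsWeaklyLaver ℵ₀ I) ∧
      ¬ IsWeaklyLaver ℵ₀ nonstationaryIdeal ∧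
      ¬ IsSaturatedIdeal (ℵ_ 2) (ℵ_ 1) ℵ₀ nonstationaryIdeal := by
  obtain ⟨A, F, hA, hF⟩ := exists_almostDisjoint_functions hMA hc hCC
  have key := not_isWeaklyLaver_of_almostDisjoint hA F hF
  refine ⟨fun ⟨I, hI⟩ => key I hI, key _, fun h => key nonstationaryIdeal ⟨?_,
    isProper_nonstationaryIdeal, isUniformIdeal_nonstationaryIdeal,
    isCompleteIdeal_nonstationaryIdeal, ?_⟩⟩
  · rw [OmegaOne.mk_eq, succ_aleph0]
  · rwa [← aleph_two_eq_succ_succ, succ_aleph0]
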